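/- Let $H_7$ be the genus-2 hyperelliptic curve $$v^2=u\left(1-\tfrac{63}{4}u+91u^2-231u^3+224u^4\right),$$ and on $H_7$ put $$P_7=v+\tfrac72u-35u^2+112u^3-128u^4,\qquad \Psi_7=\frac{P_7^{2}\,(2v-3u+14u^2)^7}{u\,(1-4u)^7\,(-2v-3u+14u^2)^7},$$ $$P_1=1344u^5-1540u^4+784u^3-204u^2+\tfrac{53}{2}u-\tfrac{11}{8}-3(28u^2-10u+1)v,$$ $$Q_1=-112u^4+84u^3-25u^2+\tfrac52u+(16u^2-4u+1)v.$$ Consider the four (multivalued) analytic functions on $H_7$ $$W_7=\sqrt{2v+3u-14u^2}\;P_7^{1/14}\,u^{-2/7}\; {}_3F_2\!\left(\begin{matrix}-\frac1{14},\frac1{14},\frac5{14}\\ \frac17,\frac57\end{matrix}\,\Big|\,\Psi_7\right), \qquad W_0=4u-1,$$ $$W_{\pm}=\left(P_1\pm Q_1\sqrt{56u-21+\tfrac2u}\,\right)^{1/4},$$ where $W_7$ is defined by the hypergeometric series where $|\Psi_7|<1$, and by analytic continuation elsewhere. Then these four functions satisfy the same linear differential equation of order $3$ with coefficients in the function field of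 $H_7$: there are polynomials $c_0,c_1,c_2,c_3\in\mathbb{C}[u,v]$, with $c_3$ not identically zero on $H_7$, such that $$c_3\,\frac{d^3W}{du^3}+c_2\,\frac{d^2W}{du^2}+c_1\,\frac{dW}{du}+c_0\,W=0$$ holds on $H_7$ for every branch $W$ of each of $W_7,W_0,W_+,W_-$. -/

import Mathlib

/-- The generalized hypergeometric series
`₃F₂(a₁, a₂, a₃; b₁, b₂ | z) = ∑ₙ (a₁)ₙ (a₂)ₙ (a₃)ₙ / ((b₁)ₙ (b₂)ₙ n!) zⁿ`, meant for `‖z‖ < 1`. -/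
noncomputable def hyp3F2 (a₁ a₂ a₃ b₁ b₂ z : ℂ) : ℂ :=
  ∑' n : ℕ, ((ascPochhammer ℂ n).eval a₁ * (ascPochhammer ℂ n).eval a₂ *
      (ascPochhammer ℂ n).eval a₃) /
    ((ascPochhammer ℂ n).eval b₁ * (ascPochhammer ℂ n).eval b₂ * (Nat.factorial n : ℂ)) * z ^ n

/-- The (affine) hyperelliptic curve `H₇` of genus 2. -/
def curveH7 : Set (ℂ × ℂ) :=
  {p | p.2 ^ 2 =
    p.1 * (1 - 63 / 4 * p.1 + 91 * p.1 ^ 2 - 231 * p.1 ^ 3 + 224 * p.1 ^ 4)}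

/-- The polynomial `P₇` in the coordinates `u, v` of `H₇`. -/
noncomputable def polyP7 (u v : ℂ) : ℂ :=
  v + 7 / 2 * u - 35 * u ^ 2 + 112 * u ^ 3 - 128 * u ^ 4

/-- The denominator of the covering `Ψ₇`. -/
noncomputable def denPsi7 (u v : ℂ) : ℂ :=
  u * (1 - 4 * u) ^ 7 * (-2 * v - 3 * u + 14 * u ^ 2) ^ 7

/-- The covering `Ψ₇ : H₇ → ℙ¹` of degree 21, as a rational function of `u, v`. -/
noncomputable def psi7 (u v : ℂ) : ℂ :=
  polyP7 u v ^ 2 * (2 * v - 3 * u + 14 * u ^ 2) ^ 7 / denPsi7 u v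

/-- The polynomial `P₁` in the coordinates `u, v` of `H₇`. -/
noncomputable def polyP1 (u v : ℂ) : ℂ :=
  1344 * u ^ 5 - 1540 * u ^ 4 + 784 * u ^ 3 - 204 * u ^ 2 + 53 / 2 * u - 11 / 8
    - 3 * (28 * u ^ 2 - 10 * u + 1) * v

/-- The polynomial `Q₁` in the coordinates `u, v` of `H₇`. -/
noncomputable def polyQ1 (u v : ℂ) : ℂ :=
  -112 * u ^ 4 + 84 * u ^ 3 - 25 * u ^ 2 + 5 / 2 * u + (16 * u ^ 2 - 4 * u + 1) * v

/-- `t ↦ (u t, v t)` is a holomorphic map from a connected open set `Ω ⊆ ℂ` to `H₇` that is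
unramified over the `u`-line. A (multivalued) analytic function on `H₇` is handled through its
single-valued branches along such maps: `Ω` may be a small disc in the `u`-line, or the universal
covering of `H₇` with finitely many points removed. -/
structure IsParamH7 (Ω : Set ℂ) (u v : ℂ → ℂ) : Prop where
  isOpen : IsOpen Ω
  isPreconnected : IsPreconnected Ω
  differentiableOn_u : DifferentiableOn ℂ u Ω
  differentiableOn_v : DifferentiableOn ℂ v Ω
  mem_curve : ∀ t ∈ Ω, (u t, v t) ∈ curveH7
  deriv_ne_zero : ∀ t ∈ Ω, deriv u t ≠ 0

/-- `s` is a holomorphic branch on `V` of the radical function `f ^ (1 / n)`. -/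
def IsRootBranch (n : ℕ) (V : Set ℂ) (f s : ℂ → ℂ) : Prop :=
  DifferentiableOn ℂ s V ∧ ∀ t ∈ V, s t ^ n = f t

/-- `W` is a branch on `Ω` of
`W₇ = (2v + 3u - 14u²)^(1/2) P₇^(1/14) u^(-2/7) ₃F₂(-1/14, 1/14, 5/14; 1/7, 5/7 | Ψ₇)`:
it is holomorphic on `Ω`, and on some nonempty open `V ⊆ Ω` with `‖Ψ₇‖ < 1` it is given by this
formula, with the convergent hypergeometric series and with some holomorphic branches of the
radicals. -/
def IsBranchW7 (Ω : Set ℂ) (u v W : ℂ → ℂ) : Prop :=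
  DifferentiableOn ℂ W Ω ∧
    ∃ (V : Set ℂ) (s p r : ℂ → ℂ), V ⊆ Ω ∧ IsOpen V ∧ V.Nonempty ∧
      IsRootBranch 2 V (fun t => 2 * v t + 3 * u t - 14 * u t ^ 2) s ∧
      IsRootBranch 14 V (fun t => polyP7 (u t) (v t)) p ∧
      IsRootBranch 7 V u r ∧
      ∀ t ∈ V, denPsi7 (u t) (v t) ≠ 0 ∧ ‖psi7 (u t) (v t)‖ < 1 ∧
        W t = s t * p t * r t ^ (-2 : ℤ) *
          hyp3F2 (-1 / 14) (1 / 14) (5 / 14) (1 / 7) (5 / 7) (psi7 (u t) (v t))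

/-- `W` is a branch on `Ω` of `(P₁ + ε Q₁ (56u - 21 + 2/u)^(1/2))^(1/4)`; here `ε = 1` gives `W₊`
and `ε = -1` gives `W₋`. It is holomorphic on `Ω` and given by the formula on some nonempty open
`V ⊆ Ω`, with some holomorphic branch of the square root. -/
def IsBranchWpm (ε : ℂ) (Ω : Set ℂ) (u v W : ℂ → ℂ) : Prop :=
  DifferentiableOn ℂ W Ω ∧
    ∃ (V : Set ℂ) (g : ℂ → ℂ), V ⊆ Ω ∧ IsOpen V ∧ V.Nonempty ∧
      IsRootBranch 2 V (fun t => 56 * u t - 21 + 2 / u t) g ∧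
      IsRootBranch 4 V (fun t => polyP1 (u t) (v t) + ε * polyQ1 (u t) (v t) * g t) W

/-- The derivation `d/du = (du/dt)⁻¹ d/dt`. -/
noncomputable def derivU (u f : ℂ → ℂ) : ℂ → ℂ := fun t => deriv f t / deriv u t

/-- `W` satisfies on `Ω` the equation `c₃ W''' + c₂ W'' + c₁ W' + c₀ W = 0`, with `' = d/du` and
with coefficients `cₖ ∈ ℂ[u][v]` (polynomials in `v` over `ℂ[u]`) evaluated along the curve. -/
def SatisfiesODE (c : Fin 4 → Polynomial (Polynomial ℂ)) (Ω : Set ℂ) (u v W : ℂ → ℂ) : Prop :=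
  ∀ t ∈ Ω, ∑ k : Fin 4, (c k).evalEval (u t) (v t) * ((derivU u)^[(k : ℕ)] W) t = 0

/-
The equation is the hypergeometric equation of `₃F₂`, pulled back along `Ψ₇` and conjugated by the
algebraic prefactor of `W₇`. Its coefficients live in the coordinate ring `ℂ[u, v]` of `H₇`, because
`Ψ₇ = -N / N*` for `N = 2 P₇ (2v - 3u + 14u²)⁷` and its conjugate `N*` under `v ↦ -v`, so that both
`dlog Ψ₇` and `(dlog Ψ₇)² / (1 - Ψ₇)` are regular once the derivation `d/du` is multiplied by a
polynomial in `u`. The functions `W₀` and `W_±` have logarithmic derivatives that are regular on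
`H₇`, respectively on its double covering by `√(56u - 21 + 2/u)`; that they are solutions is a
Riccati type identity in the coordinate ring of that curve. All this happens on a nonempty open set
away from the singularities, and the identity theorem extends the equation to the whole domain.
-/

open Polynomial

section PowerSeries

/-- The series `∑ nᵏ aₙ zⁿ`, that is `(z d/dz)ᵏ` applied to `∑ aₙ zⁿ`. -/
noncomputable def eulerSeries (a : ℕ → ℂ) (k : ℕ) (z : ℂ) : ℂ :=
  ∑' n : ℕ, (n : ℂ) ^ k * a n * z ^ n

variable {a : ℕ → ℂ} {r z : ℂ}

theorem summable_pow_mul_mul_pow (ha : Summable fun n => a n * r ^ n) (hz : ‖z‖ < ‖r‖) (k : ℕ) :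
    Summable fun n : ℕ => (n : ℂ) ^ k * a n * z ^ n := by
  have hr : r ≠ 0 := norm_pos_iff.1 ((norm_nonneg z).trans_lt hz)
  have hzr : ‖z / r‖ < 1 := by rwa [norm_div, div_lt_one (norm_pos_iff.2 hr)]
  have hbdd : (fun n => a n * r ^ n) =O[Filter.atTop] fun _ => (1 : ℝ) :=
    ha.tendsto_atTop_zero.isBigO_one ℝ
  have hgeom := (summable_pow_mul_geometric_of_norm_lt_one k hzr).norm
  refine summable_of_isBigO_nat hgeom ?_
  refine ((Asymptotics.isBigO_refl (fun n : ℕ => (n : ℂ) ^ k * (z / r) ^ n) _).norm_right.mul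
    hbdd).congr (fun n => ?_) fun n => mul_one _
  rw [div_pow]
  field_simp

theorem hasDerivAt_eulerSeries (ha : Summable fun n => a n * r ^ n) (hz : ‖z‖ < ‖r‖)
    (hz0 : z ≠ 0) (k : ℕ) :
    HasDerivAt (eulerSeries a k) (eulerSeries a (k + 1) z / z) z := by
  obtain ⟨ρ, hzρ, hρr⟩ := exists_between hz
  have hρ : 0 < ρ := (norm_nonneg z).trans_lt hzρ
  have hρ_norm : ‖(ρ : ℂ)‖ = ρ := by simp [hρ.le]
  have hterm {x : ℂ} (hx : x ≠ 0) (n : ℕ) :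
      (n : ℂ) ^ k * a n * (n * x ^ (n - 1)) = (n : ℂ) ^ (k + 1) * a n * x ^ n / x := by
    cases n with
    | zero => simp
    | succ n =>
      rw [Nat.add_sub_cancel]
      field_simp
      ring
  have hmajorant : Summable fun n : ℕ => ‖(n : ℂ) ^ (k + 1) * a n * (ρ : ℂ) ^ n / ρ‖ :=
    ((summable_pow_mul_mul_pow ha (by rwa [hρ_norm]) (k + 1)).div_const _).norm
  have hderiv : HasDerivAt (eulerSeries a k)
      (∑' n : ℕ, (n : ℂ) ^ k * a n * (n * z ^ (n - 1))) z := by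
    refine hasDerivAt_tsum_of_isPreconnected
      (g := fun (n : ℕ) (y : ℂ) => (n : ℂ) ^ k * a n * y ^ n)
      (g' := fun (n : ℕ) (y : ℂ) => (n : ℂ) ^ k * a n * (n * y ^ (n - 1)))
      (t := Metric.ball 0 ρ) hmajorant Metric.isOpen_ball (convex_ball 0 ρ).isPreconnected
      (fun n y _ => (hasDerivAt_pow n y).const_mul _) (fun n y hy => ?_)
      (by simpa using hzρ) (summable_pow_mul_mul_pow ha hz k) (by simpa using hzρ)
    have hyρ : ‖y‖ ≤ ρ := by simpa using (Metric.mem_ball.1 hy).le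
    rw [← hterm (Complex.ofReal_ne_zero.2 hρ.ne')]
    simp only [norm_mul, norm_pow, hρ_norm]
    gcongr
  simp only [hterm hz0, tsum_div_const] at hderiv
  exact hderiv

end PowerSeries

section Hypergeometric

/-- The Taylor coefficients of `₃F₂(a₁, a₂, a₃; b₁, b₂ | z)`. -/
noncomputable def hypCoeff (a₁ a₂ a₃ b₁ b₂ : ℂ) (n : ℕ) : ℂ :=
  ((ascPochhammer ℂ n).eval a₁ * (ascPochhammer ℂ n).eval a₂ * (ascPochhammer ℂ n).eval a₃) /
    ((ascPochhammer ℂ n).eval b₁ * (ascPochhammer ℂ n).eval b₂ * (Nat.factorial n : ℂ))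

variable {a₁ a₂ a₃ b₁ b₂ : ℂ}

theorem hyp3F2_eq_eulerSeries (z : ℂ) :
    hyp3F2 a₁ a₂ a₃ b₁ b₂ z = eulerSeries (hypCoeff a₁ a₂ a₃ b₁ b₂) 0 z := by
  simp only [hyp3F2, eulerSeries, hypCoeff, pow_zero, one_mul]

theorem hypCoeff_succ (n : ℕ) :
    hypCoeff a₁ a₂ a₃ b₁ b₂ (n + 1) =
      (a₁ + n) / (b₁ + n) * ((a₂ + n) / (b₂ + n)) * ((a₃ + n) / (1 + n)) *
        hypCoeff a₁ a₂ a₃ b₁ b₂ n := by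
  simp only [hypCoeff, ascPochhammer_succ_eval, Nat.factorial_succ, Nat.cast_mul, Nat.cast_add,
    Nat.cast_one, div_mul_div_comm]
  congr 1 <;> ring

theorem summable_hypCoeff {z : ℂ} (hz : ‖z‖ < 1) :
    Summable fun n => hypCoeff a₁ a₂ a₃ b₁ b₂ n * z ^ n := by
  have hfactor (a b : ℂ) : Filter.Tendsto (fun n : ℕ => (a + n) / (b + n)) Filter.atTop
      (nhds 1) := by
    simpa using tendsto_add_mul_div_add_mul_atTop_nhds a b 1 one_ne_zero
  have hratio : Filter.Tendsto (fun n : ℕ =>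
      ‖(a₁ + n) / (b₁ + n) * ((a₂ + n) / (b₂ + n)) * ((a₃ + n) / (1 + n)) * z‖)
      Filter.atTop (nhds ‖z‖) := by
    simpa using ((((hfactor a₁ b₁).mul (hfactor a₂ b₂)).mul (hfactor a₃ 1)).mul_const z).norm
  obtain ⟨r, hzr, hr⟩ := exists_between hz
  refine summable_of_ratio_norm_eventually_le hr ?_
  filter_upwards [hratio.eventually_le_const hzr] with n hn
  rw [hypCoeff_succ, pow_succ]
  refine Eq.trans_le ?_ (mul_le_mul_of_nonneg_right hn (norm_nonneg _))
  rw [← norm_mul]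
  congr 1
  ring

theorem hasDerivAt_eulerSeries_hypCoeff {z : ℂ} (hz : ‖z‖ < 1) (hz0 : z ≠ 0) (k : ℕ) :
    HasDerivAt (eulerSeries (hypCoeff a₁ a₂ a₃ b₁ b₂) k)
      (eulerSeries (hypCoeff a₁ a₂ a₃ b₁ b₂) (k + 1) z / z) z := by
  obtain ⟨r, hzr, hr⟩ := exists_between hz
  have hr_norm : ‖(r : ℂ)‖ = r := by simp [((norm_nonneg z).trans hzr.le)]
  exact hasDerivAt_eulerSeries (summable_hypCoeff (hr_norm.trans_lt hr))
    (hzr.trans_eq hr_norm.symm) hz0 k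

/-- The hypergeometric differential equation
`θ (θ + b₁ - 1) (θ + b₂ - 1) F = z (θ + a₁) (θ + a₂) (θ + a₃) F`, where `θ = z d/dz`. -/
theorem eulerSeries_hypCoeff_ode (hb₁ : ∀ n : ℕ, b₁ + n ≠ 0) (hb₂ : ∀ n : ℕ, b₂ + n ≠ 0)
    {z : ℂ} (hz : ‖z‖ < 1) :
    let G := fun k => eulerSeries (hypCoeff a₁ a₂ a₃ b₁ b₂) k z
    G 3 + (b₁ + b₂ - 2) * G 2 + (b₁ - 1) * (b₂ - 1) * G 1 =
      z * (G 3 + (a₁ + a₂ + a₃) * G 2 + (a₁ * a₂ + a₁ * a₃ + a₂ * a₃) * G 1 +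
        a₁ * a₂ * a₃ * G 0) := by
  obtain ⟨r, hzr, hr⟩ := exists_between hz
  have hr_norm : ‖(r : ℂ)‖ = r := by simp [((norm_nonneg z).trans hzr.le)]
  have hG (k : ℕ) := (summable_pow_mul_mul_pow (a := hypCoeff a₁ a₂ a₃ b₁ b₂)
    (summable_hypCoeff (hr_norm.trans_lt hr)) (hzr.trans_eq hr_norm.symm) k).hasSum
  have hleft := ((hG 3).add ((hG 2).mul_left (b₁ + b₂ - 2))).add
    ((hG 1).mul_left ((b₁ - 1) * (b₂ - 1)))
  have hright := ((((hG 3).add ((hG 2).mul_left (a₁ + a₂ + a₃))).add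
    ((hG 1).mul_left (a₁ * a₂ + a₁ * a₃ + a₂ * a₃))).add
    ((hG 0).mul_left (a₁ * a₂ * a₃))).mul_left z
  have hshift := ((hasSum_nat_add_iff' 1).2 hleft).unique (hright.congr_fun fun n => ?_)
  · simpa [eulerSeries] using hshift
  · have hn : (1 + n : ℂ) ≠ 0 := by
      rw [add_comm]
      exact n.cast_add_one_ne_zero
    have h₁ := hb₁ n
    have h₂ := hb₂ n
    rw [hypCoeff_succ]
    push_cast
    field_simp
    ring

end Hypergeometric

section Calculus

/-- On `V` the differential of `f` is `f' ω dt`: the function `f'` is the derivative of `f` for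
the derivation `ω⁻¹ d/dt`. -/
def HasDerivAlong (ω : ℂ → ℂ) (V : Set ℂ) (f f' : ℂ → ℂ) : Prop :=
  ∀ t ∈ V, HasDerivAt f (f' t * ω t) t

/-- On `V` the function `f` has the logarithmic derivative `κ` for the derivation `ω⁻¹ d/dt`. -/
def HasLogDerivAlong (ω : ℂ → ℂ) (V : Set ℂ) (f κ : ℂ → ℂ) : Prop :=
  HasDerivAlong ω V f fun t => f t * κ t

variable {ω : ℂ → ℂ} {V : Set ℂ} {f g f' g' κ μ s : ℂ → ℂ}

namespace HasDerivAlong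

theorem congr_deriv (hf : HasDerivAlong ω V f f') (h : ∀ t ∈ V, f' t = g' t) :
    HasDerivAlong ω V f g' :=
  fun t ht => h t ht ▸ hf t ht

theorem congr_fun (hf : HasDerivAlong ω V f f') (hV : IsOpen V) (h : ∀ t ∈ V, g t = f t) :
    HasDerivAlong ω V g f' :=
  fun t ht => (hf t ht).congr_of_eventuallyEq (Filter.eventuallyEq_of_mem (hV.mem_nhds ht) h)

theorem const (c : ℂ) : HasDerivAlong ω V (fun _ => c) fun _ => 0 := fun t _ => by
  simpa using hasDerivAt_const t c

theorem add (hf : HasDerivAlong ω V f f') (hg : HasDerivAlong ω V g g') :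
    HasDerivAlong ω V (fun t => f t + g t) fun t => f' t + g' t := fun t ht => by
  rw [add_mul]
  exact (hf t ht).add (hg t ht)

theorem mul (hf : HasDerivAlong ω V f f') (hg : HasDerivAlong ω V g g') :
    HasDerivAlong ω V (fun t => f t * g t) fun t => f' t * g t + f t * g' t :=
  fun t ht => ((hf t ht).mul (hg t ht)).congr_deriv (by ring)

theorem pow (hf : HasDerivAlong ω V f f') (n : ℕ) :
    HasDerivAlong ω V (fun t => f t ^ n) fun t => n * f t ^ (n - 1) * f' t :=
  fun t ht => ((hf t ht).pow n).congr_deriv (by ring)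

theorem comp {φ φ' : ℂ → ℂ} (hφ : ∀ t ∈ V, HasDerivAt φ (φ' t) (f t))
    (hf : HasDerivAlong ω V f f') :
    HasDerivAlong ω V (fun t => φ (f t)) fun t => φ' t * f' t := fun t ht => by
  rw [mul_assoc]
  exact (hφ t ht).comp t (hf t ht)

theorem unique (hf : HasDerivAlong ω V f f') (hg : HasDerivAlong ω V g g') (hV : IsOpen V)
    (hω : ∀ t ∈ V, ω t ≠ 0) (hfg : ∀ t ∈ V, f t = g t) : ∀ t ∈ V, f' t = g' t :=
  fun t ht => mul_right_cancel₀ (hω t ht) (((hg.congr_fun hV hfg) t ht).unique (hf t ht)).symm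

end HasDerivAlong

namespace HasLogDerivAlong

theorem congr_log (hf : HasLogDerivAlong ω V f κ) (h : ∀ t ∈ V, κ t = μ t) :
    HasLogDerivAlong ω V f μ :=
  HasDerivAlong.congr_deriv hf fun t ht => by rw [h t ht]

theorem congr_fun (hf : HasLogDerivAlong ω V f κ) (hV : IsOpen V) (h : ∀ t ∈ V, g t = f t) :
    HasLogDerivAlong ω V g κ :=
  (HasDerivAlong.congr_fun hf hV h).congr_deriv fun t ht => by rw [h t ht]

theorem const (c : ℂ) : HasLogDerivAlong ω V (fun _ => c) fun _ => 0 := by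
  simpa [HasLogDerivAlong] using HasDerivAlong.const (ω := ω) (V := V) c

theorem mul (hf : HasLogDerivAlong ω V f κ) (hg : HasLogDerivAlong ω V g μ) :
    HasLogDerivAlong ω V (fun t => f t * g t) fun t => κ t + μ t :=
  (HasDerivAlong.mul hf hg).congr_deriv fun t _ => by ring

theorem inv (hf : HasLogDerivAlong ω V f κ) (h0 : ∀ t ∈ V, f t ≠ 0) :
    HasLogDerivAlong ω V (fun t => (f t)⁻¹) fun t => -κ t := fun t ht => by
  refine ((hf t ht).inv (h0 t ht)).congr_deriv ?_
  have := h0 t ht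
  field_simp

theorem pow (hf : HasLogDerivAlong ω V f κ) (n : ℕ) :
    HasLogDerivAlong ω V (fun t => f t ^ n) fun t => n * κ t := by
  refine (HasDerivAlong.pow hf n).congr_deriv fun t _ => ?_
  cases n with
  | zero => simp
  | succ n =>
    rw [Nat.add_sub_cancel]
    ring

theorem div (hf : HasLogDerivAlong ω V f κ) (hg : HasLogDerivAlong ω V g μ)
    (h0 : ∀ t ∈ V, g t ≠ 0) :
    HasLogDerivAlong ω V (fun t => f t / g t) fun t => κ t - μ t := by
  simpa only [div_eq_mul_inv, sub_eq_add_neg] using hf.mul (hg.inv h0)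

theorem unique (hf : HasLogDerivAlong ω V f κ) (hf' : HasLogDerivAlong ω V f μ)
    (hω : ∀ t ∈ V, ω t ≠ 0) (h0 : ∀ t ∈ V, f t ≠ 0) : ∀ t ∈ V, κ t = μ t := fun t ht =>
  mul_left_cancel₀ (h0 t ht) (mul_right_cancel₀ (hω t ht) ((hf t ht).unique (hf' t ht)))

theorem of_isRootBranch {n : ℕ} (hn : n ≠ 0) (hV : IsOpen V) (hω : ∀ t ∈ V, ω t ≠ 0)
    (hs : IsRootBranch n V f s) (hf : HasLogDerivAlong ω V f κ) (h0 : ∀ t ∈ V, f t ≠ 0) :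
    HasLogDerivAlong ω V s fun t => κ t / n := by
  have hs0 : ∀ t ∈ V, s t ≠ 0 := fun t ht h => h0 t ht (by rw [← hs.2 t ht, h, zero_pow hn])
  have hlog : HasLogDerivAlong ω V s fun t => deriv s t / ω t / s t := fun t ht => by
    refine (hs.1.differentiableAt (hV.mem_nhds ht)).hasDerivAt.congr_deriv ?_
    beta_reduce
    rw [mul_div_cancel₀ _ (hs0 t ht), div_mul_cancel₀ _ (hω t ht)]
  have hκ := ((hlog.pow n).congr_fun hV fun t ht => (hs.2 t ht).symm).unique hf hω h0
  refine hlog.congr_log fun t ht => ?_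
  rw [← hκ t ht, mul_div_cancel_left₀ _ (Nat.cast_ne_zero.2 hn)]

end HasLogDerivAlong

end Calculus

section Jets

variable {A : Type*} [CommRing A]

/-- The chain rule: for derivations `E = ℓ Θ`, the values `F, E F, E² F, E³ F` in terms of
`G = (F, Θ F, Θ² F, Θ³ F)`, where `ℓ` stands for the triple `ℓ, E ℓ, E² ℓ`. -/
def chainJet (ℓ : Fin 3 → A) (G : Fin 4 → A) : Fin 4 → A :=
  ![G 0, ℓ 0 * G 1, ℓ 1 * G 1 + ℓ 0 ^ 2 * G 2,
    ℓ 2 * G 1 + 3 * ℓ 0 * ℓ 1 * G 2 + ℓ 0 ^ 3 * G 3]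

/-- The Leibniz rule: if `M` has the logarithmic derivative `m`, then `(M F, E (M F), …)` is `M`
times the twist by `m, E m, E² m` of `w = (F, E F, E² F, E³ F)`. -/
def twist (m : Fin 3 → A) (w : Fin 4 → A) : Fin 4 → A :=
  ![w 0, w 1 + m 0 * w 0, w 2 + 2 * m 0 * w 1 + (m 1 + m 0 ^ 2) * w 0,
    w 3 + 3 * m 0 * w 2 + 3 * (m 1 + m 0 ^ 2) * w 1 + (m 2 + 3 * m 0 * m 1 + m 0 ^ 3) * w 0]

/-- The operator `ℓ² Θ³ + r₂ Θ² + r₁ Θ + r₀` with `Θ = ℓ⁻¹ E`, conjugated by a function with the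
logarithmic derivative `m`. The triples `ℓ` and `m` also contain the first two derivatives. -/
structure PulledBackOp (A : Type*) where
  ℓ : Fin 3 → A
  m : Fin 3 → A
  r : Fin 3 → A

namespace PulledBackOp

/-- The value of the operator, multiplied by `ℓ³` to clear denominators, on a function with the
derivatives `w = (W, E W, E² W, E³ W)`. -/
def apply (L : PulledBackOp A) (w : Fin 4 → A) : A :=
  let x := twist (-L.m) w
  let y := L.ℓ 0 * x 2 - L.ℓ 1 * x 1
  L.ℓ 0 ^ 2 * x 3 - 3 * L.ℓ 1 * y - L.ℓ 0 * L.ℓ 2 * x 1 + L.r 2 * y +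
    L.r 1 * L.ℓ 0 ^ 2 * x 1 + L.r 0 * L.ℓ 0 ^ 3 * x 0

/-- The operator with all its coefficients transported along `ψ`. -/
def map {B : Type*} (ψ : A → B) (L : PulledBackOp A) : PulledBackOp B :=
  ⟨ψ ∘ L.ℓ, ψ ∘ L.m, ψ ∘ L.r⟩

theorem apply_map {B : Type*} [CommRing B] (ψ : A →+* B) (L : PulledBackOp A) (w : Fin 4 → A) :
    (L.map ψ).apply (ψ ∘ w) = ψ (L.apply w) := by
  simp [apply, map, twist, map_ofNat ψ]

theorem apply_smul (L : PulledBackOp A) (M : A) (w : Fin 4 → A) :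
    L.apply (M • w) = M * L.apply w := by
  simp only [apply, twist, Matrix.cons_val, Pi.smul_apply, smul_eq_mul]
  ring

theorem apply_eq_sum (L : PulledBackOp A) (ℓ : Fin 3 → A) (y : Fin 4 → A) :
    L.apply (chainJet ℓ y) = ∑ k, L.apply (chainJet ℓ (Pi.single k 1)) * y k := by
  simp [Fin.sum_univ_four, apply, twist, chainJet]
  ring

theorem apply_twist_single (L : PulledBackOp A) (κ : Fin 3 → A) :
    L.apply (twist κ (Pi.single 0 1)) =
      L.ℓ 0 ^ 2 * ((κ - L.m) 2 + 3 * (κ - L.m) 0 * (κ - L.m) 1 + (κ - L.m) 0 ^ 3) +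
      (L.r 2 - 3 * L.ℓ 1) * (L.ℓ 0 * ((κ - L.m) 1 + (κ - L.m) 0 ^ 2) - L.ℓ 1 * (κ - L.m) 0) +
      (L.r 1 * L.ℓ 0 ^ 2 - L.ℓ 0 * L.ℓ 2) * (κ - L.m) 0 + L.r 0 * L.ℓ 0 ^ 3 := by
  simp [apply, twist]
  ring

theorem apply_twist_chainJet (L : PulledBackOp A) (G : Fin 4 → A) :
    L.apply (twist L.m (chainJet L.ℓ G)) =
      L.ℓ 0 ^ 3 * (L.ℓ 0 ^ 2 * G 3 + L.r 2 * G 2 + L.r 1 * G 1 + L.r 0 * G 0) := by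
  simp [apply, twist, chainJet]
  ring

end PulledBackOp

/-- The iterates `x, D x, D² x, …`. -/
def jet (D : A → A) (x : A) {n : ℕ} : Fin n → A := fun k => D^[k] x

variable {n : ℕ} {ω : ℂ → ℂ} {V : Set ℂ}

/-- Along `ω`, each component of `w` is the derivative of the previous one. -/
def IsJet (ω : ℂ → ℂ) (V : Set ℂ) (w : ℂ → Fin (n + 1) → ℂ) : Prop :=
  ∀ k : Fin n, HasDerivAlong ω V (fun t => w t k.castSucc) fun t => w t k.succ

theorem IsJet.unique {w w' : ℂ → Fin (n + 1) → ℂ} (hw : IsJet ω V w) (hw' : IsJet ω V w')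
    (hV : IsOpen V) (hω : ∀ t ∈ V, ω t ≠ 0) (h0 : ∀ t ∈ V, w t 0 = w' t 0) :
    ∀ t ∈ V, w t = w' t := by
  have hk (k : Fin (n + 1)) : ∀ t ∈ V, w t k = w' t k := by
    induction k using Fin.induction with
    | zero => exact h0
    | succ k ih => exact (hw k).unique (hw' k) hV hω ih
  exact fun t ht => funext fun k => hk k t ht

theorem isJet_chainJet {ℓ : ℂ → Fin 3 → ℂ} {G : ℂ → Fin 4 → ℂ} (hℓ : IsJet ω V ℓ)
    (hG : ∀ k : Fin 3, HasDerivAlong ω V (fun t => G t k.castSucc) fun t => ℓ t 0 * G t k.succ) :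
    IsJet ω V fun t => chainJet (ℓ t) (G t) := by
  intro k
  fin_cases k
  · exact hG 0
  · exact ((hℓ 0).mul (hG 1)).congr_deriv fun t _ => by
      simp [chainJet]
      ring
  · exact (((hℓ 1).mul (hG 1)).add (((hℓ 0).pow 2).mul (hG 2))).congr_deriv fun t _ => by
      simp [chainJet]
      ring

theorem isJet_twist {M : ℂ → ℂ} {m : ℂ → Fin 3 → ℂ} {w : ℂ → Fin 4 → ℂ} (hw : IsJet ω V w)
    (hm : IsJet ω V m) (hM : HasLogDerivAlong ω V M fun t => m t 0) :
    IsJet ω V fun t => M t • twist (m t) (w t) := by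
  have hconst := HasDerivAlong.const (ω := ω) (V := V)
  intro k
  fin_cases k
  · exact (HasDerivAlong.mul hM (hw 0)).congr_deriv fun t _ => by
      simp [twist]
      ring
  · exact (HasDerivAlong.mul hM ((hw 1).add ((hm 0).mul (hw 0)))).congr_deriv fun t _ => by
      simp [twist]
      ring
  · exact (HasDerivAlong.mul hM (((hw 2).add (((hconst 2).mul (hm 0)).mul (hw 1))).add
      (((hm 1).add ((hm 0).pow 2)).mul (hw 0)))).congr_deriv fun t _ => by
        simp [twist]
        ring

/-- `W` is annihilated along `ω` by the operators `L t`, `t ∈ V`. -/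
def IsSolutionAlong (ω : ℂ → ℂ) (V : Set ℂ) (L : ℂ → PulledBackOp ℂ) (W : ℂ → ℂ) : Prop :=
  ∃ w : ℂ → Fin 4 → ℂ, IsJet ω V w ∧ ∀ t ∈ V, w t 0 = W t ∧ (L t).apply (w t) = 0

variable {L : ℂ → PulledBackOp ℂ} {M W : ℂ → ℂ}

theorem IsSolutionAlong.congr_fun {W' : ℂ → ℂ} (h : IsSolutionAlong ω V L W)
    (hW : ∀ t ∈ V, W' t = W t) : IsSolutionAlong ω V L W' := by
  obtain ⟨w, hw, hwL⟩ := h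
  exact ⟨w, hw, fun t ht => ⟨(hwL t ht).1.trans (hW t ht).symm, (hwL t ht).2⟩⟩

theorem IsSolutionAlong.of_hasLogDerivAlong {κ : ℂ → Fin 3 → ℂ} (hκ : IsJet ω V κ)
    (hM : HasLogDerivAlong ω V M fun t => κ t 0)
    (hL : ∀ t ∈ V, (L t).apply (twist (κ t) (Pi.single 0 1)) = 0) : IsSolutionAlong ω V L M := by
  have hone : IsJet ω V fun _ => (Pi.single 0 1 : Fin 4 → ℂ) := fun k => by
    simpa [Pi.single_eq_of_ne (Fin.succ_ne_zero k)] using HasDerivAlong.const _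
  refine ⟨_, isJet_twist hone hκ hM, fun t ht => ⟨by simp [twist], ?_⟩⟩
  rw [PulledBackOp.apply_smul, hL t ht, mul_zero]

theorem IsSolutionAlong.of_chainJet {G : ℂ → Fin 4 → ℂ} (hℓ : IsJet ω V fun t => (L t).ℓ)
    (hm : IsJet ω V fun t => (L t).m) (hM : HasLogDerivAlong ω V M fun t => (L t).m 0)
    (hG : ∀ k : Fin 3,
      HasDerivAlong ω V (fun t => G t k.castSucc) fun t => (L t).ℓ 0 * G t k.succ)
    (hL : ∀ t ∈ V, (L t).ℓ 0 ^ 2 * G t 3 + (L t).r 2 * G t 2 + (L t).r 1 * G t 1 +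
      (L t).r 0 * G t 0 = 0) :
    IsSolutionAlong ω V L fun t => M t * G t 0 := by
  refine ⟨_, isJet_twist (isJet_chainJet hℓ hG) hm hM,
    fun t ht => ⟨by simp [twist, chainJet], ?_⟩⟩
  rw [PulledBackOp.apply_smul, PulledBackOp.apply_twist_chainJet, hL t ht, mul_zero, mul_zero]

theorem differentiableOn_iterate_derivU {u : ℂ → ℂ} (hV : IsOpen V) (hu : DifferentiableOn ℂ u V)
    (hu' : ∀ t ∈ V, deriv u t ≠ 0) (hW : DifferentiableOn ℂ W V) (k : ℕ) :
    DifferentiableOn ℂ ((derivU u)^[k] W) V := by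
  induction k with
  | zero => exact hW
  | succ k ih =>
    rw [Function.iterate_succ_apply']
    exact (ih.deriv hV).div (hu.deriv hV) hu'

theorem IsSolutionAlong.sum_iterate_derivU_eq_zero {u : ℂ → ℂ} {π : ℂ → Fin 3 → ℂ}
    (h : IsSolutionAlong ω V L W) (hV : IsOpen V) (hu : DifferentiableOn ℂ u V)
    (hu' : ∀ t ∈ V, deriv u t ≠ 0) (hπ : IsJet ω V π) (hπu : ∀ t ∈ V, π t 0 * ω t = deriv u t)
    (hW : DifferentiableOn ℂ W V) :
    ∀ t ∈ V, ∑ k : Fin 4, (L t).apply (chainJet (π t) (Pi.single k 1)) *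
      (derivU u)^[(k : ℕ)] W t = 0 := by
  obtain ⟨w, hw, hwL⟩ := h
  have hω : ∀ t ∈ V, ω t ≠ 0 := fun t ht => right_ne_zero_of_mul (hπu t ht ▸ hu' t ht)
  have hjet : IsJet ω V fun t => chainJet (π t) (fun k : Fin 4 => (derivU u)^[(k : ℕ)] W t) :=
    isJet_chainJet hπ fun k t ht => by
      refine ((differentiableOn_iterate_derivU hV hu hu' hW k).differentiableAt
        (hV.mem_nhds ht)).hasDerivAt.congr_deriv ?_
      rw [Fin.val_succ, Function.iterate_succ_apply', mul_right_comm, hπu t ht]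
      exact (mul_div_cancel₀ _ (hu' t ht)).symm
  intro t ht
  rw [← PulledBackOp.apply_eq_sum,
    hjet.unique hw hV hω (fun t ht => by simp [chainJet, (hwL t ht).1]) t ht, (hwL t ht).2]

end Jets

section DifferentialEvaluation

variable {A : Type*} [CommRing A] {ω : ℂ → ℂ} {V : Set ℂ} {D : A → A} {φ : A → ℂ → ℂ}

/-- Evaluation of the elements of `A` as functions on `V`, under which `D` becomes `ω⁻¹ d/dt`. -/
structure IsDiffEval (ω : ℂ → ℂ) (V : Set ℂ) (D : A → A) (φ : A → ℂ → ℂ) : Prop where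
  exists_ringHom : ∀ t ∈ V, ∃ ψ : A →+* ℂ, ∀ x, φ x t = ψ x
  hasDerivAlong : ∀ x, HasDerivAlong ω V (φ x) (φ (D x))

theorem IsDiffEval.isJet (hφ : IsDiffEval ω V D φ) (x : A) {n : ℕ} :
    IsJet ω V fun t => (φ · t) ∘ jet D x (n := n + 1) := fun k => by
  simpa [jet, Function.iterate_succ_apply'] using hφ.hasDerivAlong (D^[k] x)

theorem IsDiffEval.hasLogDerivAlong (hφ : IsDiffEval ω V D φ) {x κ : A} (h : D x = x * κ) :
    HasLogDerivAlong ω V (φ x) (φ κ) :=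
  (hφ.hasDerivAlong x).congr_deriv fun t ht => by
    obtain ⟨ψ, hψ⟩ := hφ.exists_ringHom t ht
    simp only [hψ, h, map_mul]

theorem isDiffEval_eval {u : ℂ → ℂ} {p : ℂ[X]} (hu : HasDerivAlong ω V u fun t => p.eval (u t)) :
    IsDiffEval ω V (fun g => p * derivative g) fun g t => g.eval (u t) where
  exists_ringHom t _ := ⟨evalRingHom (u t), fun _ => rfl⟩
  hasDerivAlong g := (hu.comp fun t _ => g.hasDerivAt (u t)).congr_deriv fun t _ => by
    rw [eval_mul, mul_comm]

/-- The derivation of `A[√a]` that extends `D` and for which `√a` has the logarithmic derivative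
`s`; this requires `D a = 2 s a`. -/
@[simps]
def quadExt {a : A} (D : A → A) (s : A) (x : QuadraticAlgebra A a 0) : QuadraticAlgebra A a 0 :=
  ⟨D x.re, D x.im + s * x.im⟩

/-- The extension of the evaluation `φ` of `A` to `A[√a]` that sends `√a` to `y`. -/
def quadEval {a : A} (φ : A → ℂ → ℂ) (y : ℂ → ℂ) (x : QuadraticAlgebra A a 0) (t : ℂ) : ℂ :=
  φ x.re t + φ x.im t * y t

theorem quadEval_algebraMap {a x : A} {y : ℂ → ℂ} (h0 : φ 0 = 0) :
    quadEval φ y (algebraMap A (QuadraticAlgebra A a 0) x) = φ x := by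
  funext t
  simp [quadEval, h0]

theorem IsDiffEval.isDiffEval_quadEval {a s : A} {y : ℂ → ℂ} (hφ : IsDiffEval ω V D φ)
    (hV : IsOpen V) (hω : ∀ t ∈ V, ω t ≠ 0) (ha : D a = a * (2 * s))
    (hy : IsRootBranch 2 V (φ a) y) (h0 : ∀ t ∈ V, φ a t ≠ 0) :
    IsDiffEval ω V (quadExt (a := a) D s) (quadEval φ y) where
  exists_ringHom t ht := by
    obtain ⟨ψ, hψ⟩ := hφ.exists_ringHom t ht
    let : Algebra A ℂ := ψ.toAlgebra
    have hsmul (x : A) (z : ℂ) : x • z = ψ x * z := rfl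
    have hroot : y t * y t = a • (1 : ℂ) + (0 : A) • y t := by
      rw [← sq, hy.2 t ht, hψ, zero_smul, add_zero, hsmul, mul_one]
    refine ⟨(QuadraticAlgebra.lift ⟨y t, hroot⟩).toRingHom, fun x => ?_⟩
    simp [quadEval, QuadraticAlgebra.lift, hψ, hsmul]
  hasDerivAlong x := by
    have hylog := HasLogDerivAlong.of_isRootBranch two_ne_zero hV hω hy (hφ.hasLogDerivAlong ha) h0
    refine ((hφ.hasDerivAlong x.re).add ((hφ.hasDerivAlong x.im).mul hylog)).congr_deriv
      fun t ht => ?_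
    obtain ⟨ψ, hψ⟩ := hφ.exists_ringHom t ht
    simp only [quadEval, hψ, re_quadExt, im_quadExt, map_add, map_mul, map_ofNat, Nat.cast_ofNat]
    ring

theorem IsDiffEval.isSolutionAlong {M : ℂ → ℂ} {κ : A} {L : PulledBackOp A}
    (hφ : IsDiffEval ω V D φ) (hM : HasLogDerivAlong ω V M (φ κ))
    (hL : L.apply (twist (jet D κ) (Pi.single 0 1)) = 0) :
    IsSolutionAlong ω V (fun t => L.map (φ · t)) M := by
  refine .of_hasLogDerivAlong (hφ.isJet κ) hM fun t ht => ?_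
  obtain ⟨ψ, hψ⟩ := hφ.exists_ringHom t ht
  have htwist : twist (ψ ∘ jet D κ) (Pi.single 0 1) = ψ ∘ twist (jet D κ) (Pi.single 0 1) := by
    funext k
    fin_cases k <;> simp [twist, map_ofNat ψ]
  simp only [hψ]
  rw [htwist, PulledBackOp.apply_map, hL, map_zero]

theorem IsDiffEval.quadEval_ne_zero {a : A} {y : ℂ → ℂ}
    {D : QuadraticAlgebra A a 0 → QuadraticAlgebra A a 0} (hφ : IsDiffEval ω V D (quadEval φ y))
    (h0 : φ 0 = 0) {x : QuadraticAlgebra A a 0}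
    (hx : ∀ t ∈ V, φ (QuadraticAlgebra.norm x) t ≠ 0) : ∀ t ∈ V, quadEval φ y x t ≠ 0 :=
  fun t ht hxt => hx t ht <| by
    obtain ⟨ψ, hψ⟩ := hφ.exists_ringHom t ht
    rw [← quadEval_algebraMap (y := y) h0, QuadraticAlgebra.algebraMap_norm_eq_mul_star, hψ,
      map_mul, ← hψ, hxt, zero_mul]

end DifferentialEvaluation

open scoped QuadraticAlgebra

namespace curveH7

noncomputable section

/-- The polynomial with `4v² = u polyF₀(u)` on `H₇`. -/
def polyF₀ : ℂ[X] := 4 - 63 * X + 364 * X ^ 2 - 924 * X ^ 3 + 896 * X ^ 4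

/-- The polynomial with `(2v)² = polyF(u)` on `H₇`. -/
def polyF : ℂ[X] := X * polyF₀

/-- The polynomial `4u - 1` of the solution `W₀`. -/
def polyW : ℂ[X] := 4 * X - 1

/-- The polynomial with `56u - 21 + 2 / u = polyQ(u) / u`. -/
def polyQ : ℂ[X] := 56 * X ^ 2 - 21 * X + 2

/-- The polynomial with `(2v - 3u + 14u²) (-2v - 3u + 14u²) = 4u (4u - 1) polyC(u)` on `H₇`. -/
def polyC : ℂ[X] := 1 - 14 * X + 56 * X ^ 2 - 56 * X ^ 3

/-- The polynomial whose zeros are, together with that of `4u - 1`, those of the norm of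
`P₁ ± Q₁ √(56u - 21 + 2 / u)` down to `ℂ(u)`. -/
def polyH : ℂ[X] := 1 - 16 * X + 56 * X ^ 2

/-- The polynomial at whose zeros `1 - Ψ₇` has double zeros. -/
def polyL : ℂ[X] := -1 + 7 * X + 14 * X ^ 2 - 196 * X ^ 3 + 392 * X ^ 4

/-- The product of the finite singularities outside the branch points of `H₇ → ℙ¹`. -/
def polyK : ℂ[X] := polyQ * polyW * polyH * polyC

/-- The coefficient of the derivation `polyE d/du`, under which the logarithmic derivatives of all
functions in question are polynomials in `u, v`. -/
def polyE : ℂ[X] := 2 * polyF * polyK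

/-- The coordinate ring of `H₇`, with `⟨a, b⟩` standing for `a(u) + 2v b(u)`. -/
abbrev CoordRing := QuadraticAlgebra ℂ[X] polyF 0

/-- The derivation `polyE d/du` of the coordinate ring. -/
def der : CoordRing → CoordRing :=
  quadExt (fun g => polyE * derivative g) (polyK * derivative polyF)

/-- The square of `u √(56u - 21 + 2 / u)`. -/
@[simps] def radicand : CoordRing := ⟨X * polyQ, 0⟩

/-- The coordinate ring of the double covering of `H₇` on which `W₊⁴` and `W₋⁴` are rational
functions, with `⟨a, b⟩` standing for `a + b u √(56u - 21 + 2 / u)`. -/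
abbrev CoverRing := QuadraticAlgebra CoordRing radicand 0

/-- The logarithmic derivative of `u √(56u - 21 + 2 / u)`. -/
@[simps] def dlogSqrt : CoordRing :=
  ⟨polyF₀ * polyW * polyH * polyC * (2 - 42 * X + 168 * X ^ 2), 0⟩

/-- The derivation `polyE d/du` of the double covering. -/
def derCover : CoverRing → CoverRing := quadExt der dlogSqrt

/-- The logarithmic derivative of `u`. -/
@[simps] def dlogU : CoordRing := ⟨2 * polyF₀ * polyK, 0⟩

/-- The logarithmic derivative of `W₀ = 4u - 1`. -/
@[simps] def dlogW : CoordRing := ⟨8 * polyF * polyQ * polyH * polyC, 0⟩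

/-- The function `2 P₇`. -/
@[simps] def twoP7 : CoordRing := ⟨7 * X - 70 * X ^ 2 + 224 * X ^ 3 - 256 * X ^ 4, 1⟩

/-- The logarithmic derivative of `P₇`. -/
@[simps] def dlogP7 : CoordRing :=
  ⟨polyQ * polyH * polyC * (polyF₀ * polyW + 28 * polyF),
    polyQ * polyH * polyC * (-7 + 42 * X)⟩

/-- The function `2v - 3u + 14u²`. Its conjugate is, up to sign, the function under the square root
in `W₇`. -/
@[simps] def gPlus : CoordRing := ⟨-3 * X + 14 * X ^ 2, 1⟩

/-- The logarithmic derivative of `gPlus`. -/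
@[simps] def dlogG : CoordRing :=
  ⟨polyQ * polyH * (polyF₀ * polyW * polyC + 4 * polyF * polyC +
      polyF * polyW * (-14 + 112 * X - 168 * X ^ 2)),
    polyQ * polyH *
      (3 - 42 * X + 168 * X ^ 2 + 112 * X ^ 3 - 2016 * X ^ 4 + 3136 * X ^ 5)⟩

/-- The numerator in the presentation `Ψ₇ = -psiNum / star psiNum` by conjugate functions. -/
def psiNum : CoordRing := twoP7 * gPlus ^ 7

/-- One fourteenth of the logarithmic derivative of `Ψ₇`; the exponents of the hypergeometric
equation have the common denominator `14`. -/
@[simps] def dlogPsi : CoordRing := ⟨0, 2 * polyQ * polyW * polyH * polyL⟩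

/-- The logarithmic derivative of the prefactor of the hypergeometric function in `W₇`. -/
@[simps] def dlogFactor : CoordRing :=
  ⟨polyF * polyQ * polyH * (11 - 140 * X + 532 * X ^ 2 - 560 * X ^ 3),
    polyQ * polyH * (-2 + 31 * X - 154 * X ^ 2 + 140 * X ^ 3 + 840 * X ^ 4 - 1568 * X ^ 5)⟩

/-- The function for which `psiNum * psiCofactor` is invariant under conjugation. -/
@[simps] def psiCofactor : CoordRing :=
  ⟨polyQ * polyL ^ 2, 7 - 196 * X + 2401 * X ^ 2 - 16954 * X ^ 3 + 75656 * X ^ 4 -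
    214032 * X ^ 5 + 345744 * X ^ 6 - 208544 * X ^ 7 - 87808 * X ^ 8⟩

/-- The quotient of `dlogPsi ^ 2` by `1 - Ψ₇`. -/
def dlogPsiSqDiv : CoordRing :=
  algebraMap ℂ[X] CoordRing (2 * polyF * polyQ * polyW ^ 2 * polyH ^ 2) * psiCofactor

/-- The function `8u (P₁ + Q₁ √(56u - 21 + 2 / u))`. -/
@[simps] def radical : CoverRing :=
  ⟨⟨X * (-11 + 212 * X - 1632 * X ^ 2 + 6272 * X ^ 3 - 12320 * X ^ 4 + 10752 * X ^ 5),
      -12 * X * (28 * X ^ 2 - 10 * X + 1)⟩,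
    ⟨20 * X - 200 * X ^ 2 + 672 * X ^ 3 - 896 * X ^ 4, 4 * (16 * X ^ 2 - 4 * X + 1)⟩⟩

/-- The norm of `radical` down to the coordinate ring of `H₇`, divided by `u²`. -/
@[simps] def radicalNorm : CoordRing :=
  ⟨-7 - 504 * X + 15232 * X ^ 2 - 153216 * X ^ 3 + 594496 * X ^ 4 + 774144 * X ^ 5 -
      16966656 * X ^ 6 + 72941568 * X ^ 7 - 158971904 * X ^ 8 + 183042048 * X ^ 9 -
      89915392 * X ^ 10,
    -56 + 112 * X + 12768 * X ^ 2 - 149632 * X ^ 3 + 725760 * X ^ 4 - 1752576 * X ^ 5 +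
      2028544 * X ^ 6 - 802816 * X ^ 7⟩

/-- The logarithmic derivative of `W₊`. -/
@[simps] def dlogWpm : CoverRing :=
  ⟨⟨2 * polyF * polyQ * polyC * (7 - 92 * X + 280 * X ^ 2),
      2 * polyQ * polyC * (-2 + 35 * X - 210 * X ^ 2 + 448 * X ^ 3 - 112 * X ^ 4)⟩,
    ⟨2 * polyC * polyF₀ * (-1 + 15 * X - 84 * X ^ 2 + 168 * X ^ 3),
      2 * polyC * (5 - 95 * X + 686 * X ^ 2 - 2240 * X ^ 3 + 2800 * X ^ 4)⟩⟩

/-- The hypergeometric operator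
`θ (θ + b₁ - 1) (θ + b₂ - 1) - Ψ (θ + a₁) (θ + a₂) (θ + a₃)` of `W₇`, divided by `1 - Ψ`, pulled
back along `Ψ = Ψ₇` and multiplied by `dlogPsi ^ 2`, in terms of `14 θ`; it is conjugated by the
prefactor of `W₇`. -/
@[simps] def odeOp : PulledBackOp CoordRing :=
  ⟨jet der dlogPsi, jet der dlogFactor,
    ![5 * (dlogPsiSqDiv - dlogPsi ^ 2), 49 * dlogPsiSqDiv - dlogPsi ^ 2,
      5 * dlogPsi ^ 2 - 21 * dlogPsiSqDiv]⟩

end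

theorem der_star (x : CoordRing) : der (star x) = star (der x) := by
  apply QuadraticAlgebra.ext
  all_goals simp [der]
  ring

theorem der_algebraMap (g : ℂ[X]) :
    der (algebraMap ℂ[X] CoordRing g) = algebraMap ℂ[X] CoordRing (polyE * derivative g) := by
  apply QuadraticAlgebra.ext <;> simp [der]

theorem der_X :
    der (algebraMap ℂ[X] CoordRing X) = algebraMap ℂ[X] CoordRing X * dlogU := by
  rw [der_algebraMap]
  apply QuadraticAlgebra.ext
  all_goals simp [polyE, polyF]
  ring

theorem der_polyW :
    der (algebraMap ℂ[X] CoordRing polyW) = algebraMap ℂ[X] CoordRing polyW * dlogW := by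
  rw [der_algebraMap]
  apply QuadraticAlgebra.ext
  all_goals simp [polyE, polyK, polyW, map_ofNat]
  ring

theorem der_twoP7 : der twoP7 = twoP7 * dlogP7 := by
  apply QuadraticAlgebra.ext
  all_goals simp [der]
  all_goals simp [polyE, polyK, polyF, polyF₀, polyW, map_ofNat]
  all_goals ring

theorem der_gPlus : der gPlus = gPlus * dlogG := by
  apply QuadraticAlgebra.ext
  all_goals simp [der]
  all_goals simp [polyE, polyK, polyF, polyF₀, polyW, polyC, map_ofNat]
  all_goals ring

theorem der_radicand : der radicand = radicand * (2 * dlogSqrt) := by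
  apply QuadraticAlgebra.ext
  all_goals simp [der]
  all_goals simp [polyE, polyK, polyF, polyQ]
  ring

theorem derCover_radical :
    derCover radical = radical * (4 * dlogWpm + algebraMap CoordRing CoverRing dlogU) := by
  apply QuadraticAlgebra.ext <;> apply QuadraticAlgebra.ext
  all_goals simp [derCover, der]
  all_goals simp [polyE, polyK, polyF, polyF₀, polyQ, polyW, polyH, polyC, map_ofNat]
  all_goals ring

theorem norm_twoP7 : QuadraticAlgebra.norm twoP7 = 4 * X * polyW ^ 7 := by
  rw [QuadraticAlgebra.norm_def]
  simp [polyF, polyF₀, polyW]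
  ring

theorem norm_gPlus : QuadraticAlgebra.norm gPlus = 4 * X * polyW * polyC := by
  rw [QuadraticAlgebra.norm_def]
  simp [polyF, polyF₀, polyW, polyC]
  ring

theorem norm_radical :
    QuadraticAlgebra.norm radical = algebraMap ℂ[X] CoordRing X ^ 2 * radicalNorm := by
  rw [QuadraticAlgebra.norm_def, pow_two]
  apply QuadraticAlgebra.ext
  all_goals simp
  all_goals simp [polyF, polyF₀, polyQ]
  all_goals ring

theorem norm_radicalNorm :
    QuadraticAlgebra.norm radicalNorm = 49 * polyW ^ 12 * polyH ^ 4 := by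
  rw [QuadraticAlgebra.norm_def]
  simp [polyF, polyF₀, polyW, polyH]
  ring

theorem fourteen_mul_dlogPsi :
    14 * dlogPsi = dlogP7 + 7 * dlogG - star (dlogP7 + 7 * dlogG) := by
  apply QuadraticAlgebra.ext
  all_goals simp
  all_goals simp [polyW, polyC, polyL]
  all_goals ring

theorem fourteen_mul_dlogFactor :
    14 * dlogFactor = 7 * star dlogG + dlogP7 - 4 * dlogU := by
  apply QuadraticAlgebra.ext
  all_goals simp
  all_goals simp [polyK, polyF, polyF₀, polyW, polyC]
  all_goals ring

theorem star_psiNum_mul_psiCofactor :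
    star (psiNum * psiCofactor) = psiNum * psiCofactor := by
  have him : (psiNum * psiCofactor).im = 0 := by
    have hpow : gPlus ^ 7 =
        gPlus * (gPlus * gPlus) * ((gPlus * gPlus) * (gPlus * gPlus)) := by ring
    rw [psiNum, hpow]
    simp only [QuadraticAlgebra.re_mul, QuadraticAlgebra.im_mul, re_twoP7, im_twoP7, re_gPlus,
      im_gPlus, re_psiCofactor, im_psiCofactor]
    simp only [polyF, polyF₀, polyL, polyQ]
    ring
  generalize psiNum * psiCofactor = x at him ⊢
  apply QuadraticAlgebra.ext <;> simp [him]

theorem dlogPsiSqDiv_mul_add :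
    dlogPsiSqDiv * (psiNum + star psiNum) = dlogPsi ^ 2 * star psiNum := by
  have hinv := star_psiNum_mul_psiCofactor
  rw [star_mul'] at hinv
  have hsq : algebraMap ℂ[X] CoordRing (2 * polyF * polyQ * polyW ^ 2 * polyH ^ 2) *
      (psiCofactor + star psiCofactor) = dlogPsi ^ 2 := by
    rw [pow_two dlogPsi]
    apply QuadraticAlgebra.ext
    all_goals simp only [QuadraticAlgebra.re_mul, QuadraticAlgebra.im_mul,
      QuadraticAlgebra.algebraMap_re, QuadraticAlgebra.algebraMap_im]
    all_goals simp
    ring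
  rw [← hsq, dlogPsiSqDiv]
  linear_combination -algebraMap ℂ[X] CoordRing (2 * polyF * polyQ * polyW ^ 2 * polyH ^ 2) * hinv

@[simp]
theorem re_dlogPsiSqDiv : dlogPsiSqDiv.re =
    2 * polyF * polyQ * polyW ^ 2 * polyH ^ 2 * psiCofactor.re := by
  simp only [dlogPsiSqDiv, QuadraticAlgebra.re_mul, QuadraticAlgebra.algebraMap_re,
    QuadraticAlgebra.algebraMap_im]
  ring

@[simp]
theorem im_dlogPsiSqDiv : dlogPsiSqDiv.im =
    2 * polyF * polyQ * polyW ^ 2 * polyH ^ 2 * psiCofactor.im := by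
  simp only [dlogPsiSqDiv, QuadraticAlgebra.im_mul, QuadraticAlgebra.algebraMap_re,
    QuadraticAlgebra.algebraMap_im]
  ring

set_option maxHeartbeats 4000000 in
-- `ring` normalizes polynomials in `X` of degree about 60.
set_option maxRecDepth 100000 in
theorem odeOp_apply_dlogW : odeOp.apply (twist (jet der dlogW) (Pi.single 0 1)) = 0 := by
  rw [PulledBackOp.apply_twist_single]
  simp only [odeOp_ℓ, odeOp_m, odeOp_r, Pi.sub_apply, jet, Fin.val_zero, Fin.val_one, Fin.val_two,
    Function.iterate_succ_apply', Function.iterate_zero_apply, Matrix.cons_val]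
  apply QuadraticAlgebra.ext
  all_goals simp [der, pow_two, pow_three]
  all_goals simp [polyE, polyK, polyF, polyF₀, polyQ, polyW, polyC, polyH, polyL, pow_two,
    pow_three, map_ofNat]
  all_goals ring

set_option maxHeartbeats 4000000 in
-- `ring` normalizes polynomials in `X` of degree about 60.
set_option maxRecDepth 100000 in
theorem odeOp_apply_dlogWpm :
    (odeOp.map (algebraMap CoordRing CoverRing)).apply
      (twist (jet derCover dlogWpm) (Pi.single 0 1)) = 0 := by
  rw [PulledBackOp.apply_twist_single]
  simp only [PulledBackOp.map, odeOp_ℓ, odeOp_m, odeOp_r, Pi.sub_apply, jet, Fin.val_zero,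
    Fin.val_one, Fin.val_two, Function.iterate_succ_apply', Function.iterate_zero_apply,
    Matrix.cons_val, Function.comp_apply]
  apply QuadraticAlgebra.ext <;> apply QuadraticAlgebra.ext
  all_goals simp [der, derCover, pow_two, pow_three]
  all_goals simp [polyE, polyK, polyF, polyF₀, polyQ, polyW, polyC, polyH, polyL, pow_two,
    pow_three, map_ofNat]
  all_goals ring

variable {V : Set ℂ} {u v : ℂ → ℂ}

/-- Evaluation of the coordinate ring of `H₇` along `t ↦ (u t, v t)`. -/
noncomputable def evalCurve (u v : ℂ → ℂ) : CoordRing → ℂ → ℂ :=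
  quadEval (fun (g : ℂ[X]) t => g.eval (u t)) fun t => 2 * v t

/-- Evaluation of the ring of the double covering, with the branch `g` of
`√(56u - 21 + 2 / u)`. -/
noncomputable def evalCover (u v g : ℂ → ℂ) : CoverRing → ℂ → ℂ :=
  quadEval (evalCurve u v) fun t => u t * g t

/-- The coefficient of the differential form `du / polyE(u)`, which is dual to the derivation
`polyE d/du`. -/
noncomputable def baseForm (u : ℂ → ℂ) (t : ℂ) : ℂ := deriv u t / polyE.eval (u t)

/-- The equation of `W₇`, evaluated along `t ↦ (u t, v t)`. -/
noncomputable def odeOpAt (u v : ℂ → ℂ) (t : ℂ) : PulledBackOp ℂ := odeOp.map (evalCurve u v · t)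

/-- A holomorphic map from an open set to `H₇` as in `IsParamH7`, with a source that need not be
connected, and with an image that avoids the singularities of the equation. -/
structure IsGenericOn (V : Set ℂ) (u v : ℂ → ℂ) : Prop where
  isOpen : IsOpen V
  differentiableOn_u : DifferentiableOn ℂ u V
  differentiableOn_v : DifferentiableOn ℂ v V
  mem_curve : ∀ t ∈ V, (u t, v t) ∈ curveH7
  deriv_ne_zero : ∀ t ∈ V, deriv u t ≠ 0
  ne_zero : ∀ t ∈ V, polyE.eval (u t) ≠ 0

/-- The lift of an element of the coordinate ring of `H₇` to a polynomial in `v` over `ℂ[u]`. -/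
noncomputable def toBivariate (x : CoordRing) : ℂ[X][X] := C x.re + X * C (2 * x.im)

theorem evalCurve_zero : evalCurve u v 0 = 0 := by
  funext t
  simp [evalCurve, quadEval]

theorem evalCurve_algebraMap (g : ℂ[X]) :
    evalCurve u v (algebraMap ℂ[X] CoordRing g) = fun t => g.eval (u t) :=
  quadEval_algebraMap (funext fun _ => eval_zero)

theorem evalCover_algebraMap (g : ℂ → ℂ) (x : CoordRing) :
    evalCover u v g (algebraMap CoordRing CoverRing x) = evalCurve u v x :=
  quadEval_algebraMap evalCurve_zero

theorem evalCurve_twoP7 (t : ℂ) : evalCurve u v twoP7 t = 2 * polyP7 (u t) (v t) := by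
  simp [evalCurve, quadEval, polyP7]
  ring

theorem evalCurve_gPlus (t : ℂ) :
    evalCurve u v gPlus t = 2 * v t - 3 * u t + 14 * u t ^ 2 := by
  simp [evalCurve, quadEval]
  ring

theorem evalCurve_star_gPlus (t : ℂ) :
    evalCurve u v (star gPlus) t = -2 * v t - 3 * u t + 14 * u t ^ 2 := by
  simp [evalCurve, quadEval]
  ring

theorem evalCover_radical (g : ℂ → ℂ) (t : ℂ) :
    evalCover u v g radical t =
      8 * u t * (polyP1 (u t) (v t) + polyQ1 (u t) (v t) * g t) := by
  simp [evalCover, evalCurve, quadEval, polyP1, polyQ1]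
  ring

/-- The functions `F, 14 θ F, (14 θ)² F, (14 θ)³ F` for the hypergeometric function `F` in `W₇`,
where `θ = z d/dz`. -/
noncomputable def eulerW₇ (z : ℂ) (k : Fin 4) : ℂ :=
  14 ^ (k : ℕ) * eulerSeries (hypCoeff (-1 / 14) (1 / 14) (5 / 14) (1 / 7) (5 / 7)) k z

theorem eulerW₇_ode {z : ℂ} (hz : ‖z‖ < 1) :
    (1 - z) * eulerW₇ z 3 - (16 + 5 * z) * eulerW₇ z 2 + (48 + z) * eulerW₇ z 1 +
      5 * z * eulerW₇ z 0 = 0 := by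
  have hb (m n : ℕ) (hm : m ≠ 0) : (m / 7 : ℂ) + n ≠ 0 := fun h => by
    have hmn : ((m + 7 * n : ℕ) : ℂ) = 0 := by
      push_cast
      linear_combination 7 * h
    exact hm (Nat.add_eq_zero_iff.1 (Nat.cast_eq_zero.1 hmn)).1
  have hode := eulerSeries_hypCoeff_ode (a₁ := -1 / 14) (a₂ := 1 / 14) (a₃ := 5 / 14)
    (b₁ := 1 / 7) (b₂ := 5 / 7) (fun n => mod_cast hb 1 n one_ne_zero)
    (fun n => mod_cast hb 5 n (by norm_num)) hz
  simp only [eulerW₇, Fin.coe_ofNat_eq_mod, Nat.reduceMod]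
  linear_combination 2744 * hode

namespace IsGenericOn

theorem factors_ne_zero (h : IsGenericOn V u v) {t : ℂ} (ht : t ∈ V) :
    u t ≠ 0 ∧ polyQ.eval (u t) ≠ 0 ∧ polyW.eval (u t) ≠ 0 ∧ polyH.eval (u t) ≠ 0 ∧
      polyC.eval (u t) ≠ 0 := by
  have hE := h.ne_zero t ht
  simp only [polyE, polyK, polyF, eval_mul, eval_X, mul_ne_zero_iff] at hE
  obtain ⟨⟨-, hu, -⟩, ⟨⟨hQ, hW⟩, hH⟩, hC⟩ := hE
  exact ⟨hu, hQ, hW, hH, hC⟩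

theorem polyF_eval_ne_zero (h : IsGenericOn V u v) {t : ℂ} (ht : t ∈ V) : polyF.eval (u t) ≠ 0 := by
  have hE := h.ne_zero t ht
  simp only [polyE, eval_mul, mul_ne_zero_iff] at hE
  exact hE.1.2

theorem baseForm_ne_zero (h : IsGenericOn V u v) : ∀ t ∈ V, baseForm u t ≠ 0 := fun t ht =>
  div_ne_zero (h.deriv_ne_zero t ht) (h.ne_zero t ht)

theorem isDiffEval_eval_u (h : IsGenericOn V u v) :
    IsDiffEval (baseForm u) V (fun g => polyE * derivative g) fun g t => g.eval (u t) :=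
  isDiffEval_eval fun t ht => by
    rw [baseForm, mul_div_cancel₀ _ (h.ne_zero t ht)]
    exact (h.differentiableOn_u.differentiableAt (h.isOpen.mem_nhds ht)).hasDerivAt

theorem isDiffEval_evalCurve (h : IsGenericOn V u v) :
    IsDiffEval (baseForm u) V der (evalCurve u v) := by
  refine h.isDiffEval_eval_u.isDiffEval_quadEval h.isOpen h.baseForm_ne_zero (by rw [polyE]; ring)
    ⟨h.differentiableOn_v.const_mul 2, fun t ht => ?_⟩ fun t ht => h.polyF_eval_ne_zero ht
  have hcurve : v t ^ 2 = _ := h.mem_curve t ht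
  rw [mul_pow, hcurve]
  simp [polyF, polyF₀]
  ring

theorem isDiffEval_evalCover (h : IsGenericOn V u v) {g : ℂ → ℂ}
    (hg : IsRootBranch 2 V (fun t => 56 * u t - 21 + 2 / u t) g) :
    IsDiffEval (baseForm u) V derCover (evalCover u v g) := by
  have hradicand (t : ℂ) : evalCurve u v radicand t = u t * polyQ.eval (u t) := by
    simp [evalCurve, quadEval]
  refine h.isDiffEval_evalCurve.isDiffEval_quadEval h.isOpen h.baseForm_ne_zero der_radicand
    ⟨h.differentiableOn_u.mul hg.1, fun t ht => ?_⟩ fun t ht => ?_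
  · have hu := (h.factors_ne_zero ht).1
    rw [hradicand, mul_pow, hg.2 t ht]
    simp [polyQ]
    field_simp
  · obtain ⟨hu, hQ, -⟩ := h.factors_ne_zero ht
    rw [hradicand]
    exact mul_ne_zero hu hQ

theorem evalCurve_ne_zero (h : IsGenericOn V u v) {x : CoordRing}
    (hx : ∀ t ∈ V, (QuadraticAlgebra.norm x).eval (u t) ≠ 0) :
    ∀ t ∈ V, evalCurve u v x t ≠ 0 :=
  h.isDiffEval_evalCurve.quadEval_ne_zero (funext fun _ => eval_zero) hx

theorem evalCurve_twoP7_ne_zero (h : IsGenericOn V u v) : ∀ t ∈ V, evalCurve u v twoP7 t ≠ 0 :=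
  h.evalCurve_ne_zero fun t ht => by
    obtain ⟨hu, -, hW, -⟩ := h.factors_ne_zero ht
    simp [norm_twoP7, hu, hW]

theorem evalCurve_star_twoP7_ne_zero (h : IsGenericOn V u v) :
    ∀ t ∈ V, evalCurve u v (star twoP7) t ≠ 0 :=
  h.evalCurve_ne_zero fun t ht => by
    obtain ⟨hu, -, hW, -⟩ := h.factors_ne_zero ht
    simp [QuadraticAlgebra.norm_star, norm_twoP7, hu, hW]

theorem evalCurve_gPlus_ne_zero (h : IsGenericOn V u v) : ∀ t ∈ V, evalCurve u v gPlus t ≠ 0 :=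
  h.evalCurve_ne_zero fun t ht => by
    obtain ⟨hu, -, hW, -, hC⟩ := h.factors_ne_zero ht
    simp [norm_gPlus, hu, hW, hC]

theorem evalCurve_star_gPlus_ne_zero (h : IsGenericOn V u v) :
    ∀ t ∈ V, evalCurve u v (star gPlus) t ≠ 0 :=
  h.evalCurve_ne_zero fun t ht => by
    obtain ⟨hu, -, hW, -, hC⟩ := h.factors_ne_zero ht
    simp [QuadraticAlgebra.norm_star, norm_gPlus, hu, hW, hC]

theorem evalCover_radical_ne_zero (h : IsGenericOn V u v) {g : ℂ → ℂ}
    (hg : IsRootBranch 2 V (fun t => 56 * u t - 21 + 2 / u t) g) :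
    ∀ t ∈ V, evalCover u v g radical t ≠ 0 :=
  (h.isDiffEval_evalCover hg).quadEval_ne_zero evalCurve_zero fun t ht => by
    obtain ⟨ψ, hψ⟩ := h.isDiffEval_evalCurve.exists_ringHom t ht
    rw [norm_radical, hψ, map_mul, map_pow, ← hψ, ← hψ, evalCurve_algebraMap]
    refine mul_ne_zero (pow_ne_zero 2 ?_) (h.evalCurve_ne_zero (fun t ht => ?_) t ht)
    · simpa using (h.factors_ne_zero ht).1
    · obtain ⟨-, -, hW, hH, -⟩ := h.factors_ne_zero ht
      simp [norm_radicalNorm, hW, hH]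

theorem isSolutionAlong_W₀ (h : IsGenericOn V u v) :
    IsSolutionAlong (baseForm u) V (odeOpAt u v) fun t => 4 * u t - 1 := by
  have hlog := h.isDiffEval_evalCurve.hasLogDerivAlong der_polyW
  refine h.isDiffEval_evalCurve.isSolutionAlong (hlog.congr_fun h.isOpen fun t _ => ?_)
    odeOp_apply_dlogW
  rw [evalCurve_algebraMap]
  simp [polyW]

theorem hasLogDerivAlong_u (h : IsGenericOn V u v) :
    HasLogDerivAlong (baseForm u) V u (evalCurve u v dlogU) :=
  (h.isDiffEval_evalCurve.hasLogDerivAlong der_X).congr_fun h.isOpen fun t _ => by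
    simp [evalCurve_algebraMap]

theorem isSolutionAlong_Wpm (h : IsGenericOn V u v) {g W : ℂ → ℂ}
    (hg : IsRootBranch 2 V (fun t => 56 * u t - 21 + 2 / u t) g)
    (hW : IsRootBranch 4 V (fun t => polyP1 (u t) (v t) + polyQ1 (u t) (v t) * g t) W) :
    IsSolutionAlong (baseForm u) V (odeOpAt u v) W := by
  have hφ := h.isDiffEval_evalCover hg
  have hu0 : ∀ t ∈ V, 8 * u t ≠ 0 := fun t ht =>
    mul_ne_zero (by norm_num) (h.factors_ne_zero ht).1
  have hfun : ∀ t ∈ V, polyP1 (u t) (v t) + polyQ1 (u t) (v t) * g t =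
      evalCover u v g radical t / (8 * u t) := fun t ht => by
    rw [evalCover_radical, mul_div_cancel_left₀ _ (hu0 t ht)]
  have hlog : HasLogDerivAlong (baseForm u) V
      (fun t => polyP1 (u t) (v t) + polyQ1 (u t) (v t) * g t)
      fun t => 4 * evalCover u v g dlogWpm t := by
    refine (((hφ.hasLogDerivAlong derCover_radical).div
      ((HasLogDerivAlong.const 8).mul h.hasLogDerivAlong_u) hu0).congr_fun h.isOpen
      hfun).congr_log fun t ht => ?_
    obtain ⟨ψ, hψ⟩ := hφ.exists_ringHom t ht
    rw [← evalCover_algebraMap g]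
    simp only [hψ, map_add, map_mul, map_ofNat]
    ring
  have hWlog : HasLogDerivAlong (baseForm u) V W (evalCover u v g dlogWpm) :=
    (HasLogDerivAlong.of_isRootBranch four_ne_zero h.isOpen h.baseForm_ne_zero hW hlog
      fun t ht => hfun t ht ▸
        div_ne_zero (h.evalCover_radical_ne_zero hg t ht) (hu0 t ht)).congr_log fun t _ => by
      push_cast
      ring
  have hop : odeOpAt u v = fun t =>
      (odeOp.map (algebraMap CoordRing CoverRing)).map (evalCover u v g · t) := by
    funext t
    simp only [odeOpAt, PulledBackOp.map, Function.comp_def, evalCover_algebraMap]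
  exact hop ▸ hφ.isSolutionAlong hWlog odeOp_apply_dlogWpm

theorem psi7_eq (h : IsGenericOn V u v) : ∀ t ∈ V, psi7 (u t) (v t) =
    -(evalCurve u v twoP7 t * evalCurve u v gPlus t ^ 7) /
      (evalCurve u v (star twoP7) t * evalCurve u v (star gPlus) t ^ 7) := fun t ht => by
  have hnorm : evalCurve u v twoP7 t * evalCurve u v (star twoP7) t =
      4 * u t * (4 * u t - 1) ^ 7 := by
    obtain ⟨ψ, hψ⟩ := h.isDiffEval_evalCurve.exists_ringHom t ht
    rw [hψ, hψ, ← map_mul, ← QuadraticAlgebra.algebraMap_norm_eq_mul_star, ← hψ,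
      evalCurve_algebraMap, norm_twoP7]
    simp [polyW]
  have hP := h.evalCurve_twoP7_ne_zero t ht
  have hG := h.evalCurve_star_gPlus_ne_zero t ht
  have hPstar := h.evalCurve_star_twoP7_ne_zero t ht
  have hden : denPsi7 (u t) (v t) =
      -(evalCurve u v twoP7 t * evalCurve u v (star twoP7) t *
        evalCurve u v (star gPlus) t ^ 7) / 4 := by
    rw [hnorm, evalCurve_star_gPlus, denPsi7]
    ring
  rw [psi7, hden, ← evalCurve_gPlus, eq_div_of_mul_eq two_ne_zero
    ((mul_comm _ _).trans (evalCurve_twoP7 t).symm)]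
  field_simp
  ring

theorem psi7_ne_zero (h : IsGenericOn V u v) : ∀ t ∈ V, psi7 (u t) (v t) ≠ 0 := fun t ht => by
  rw [h.psi7_eq t ht]
  exact div_ne_zero (neg_ne_zero.2 (mul_ne_zero (h.evalCurve_twoP7_ne_zero t ht)
    (pow_ne_zero 7 (h.evalCurve_gPlus_ne_zero t ht)))) (mul_ne_zero
    (h.evalCurve_star_twoP7_ne_zero t ht) (pow_ne_zero 7 (h.evalCurve_star_gPlus_ne_zero t ht)))

theorem hasLogDerivAlong_star (h : IsGenericOn V u v) {x κ : CoordRing} (hx : der x = x * κ) :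
    HasLogDerivAlong (baseForm u) V (evalCurve u v (star x)) (evalCurve u v (star κ)) :=
  h.isDiffEval_evalCurve.hasLogDerivAlong <| by rw [der_star, hx, star_mul']

theorem hasLogDerivAlong_psi7 (h : IsGenericOn V u v) :
    HasLogDerivAlong (baseForm u) V (fun t => psi7 (u t) (v t))
      fun t => 14 * evalCurve u v dlogPsi t := by
  have hφ := h.isDiffEval_evalCurve
  have hnum := (HasLogDerivAlong.const (-1)).mul
    ((hφ.hasLogDerivAlong der_twoP7).mul ((hφ.hasLogDerivAlong der_gPlus).pow 7))
  have hden := (h.hasLogDerivAlong_star der_twoP7).mul ((h.hasLogDerivAlong_star der_gPlus).pow 7)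
  refine ((hnum.div hden fun t ht => mul_ne_zero (h.evalCurve_star_twoP7_ne_zero t ht)
    (pow_ne_zero 7 (h.evalCurve_star_gPlus_ne_zero t ht))).congr_fun h.isOpen fun t ht => by
      rw [h.psi7_eq t ht, neg_one_mul]).congr_log fun t ht => ?_
  obtain ⟨ψ, hψ⟩ := hφ.exists_ringHom t ht
  have h14 := congrArg ψ fourteen_mul_dlogPsi
  simp only [star_add, star_mul', star_ofNat, map_sub, map_add, map_mul, map_ofNat] at h14
  simp only [hψ, h14]
  push_cast
  ring

theorem dlogPsiSqDiv_mul_one_sub_psi7 (h : IsGenericOn V u v) : ∀ t ∈ V,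
    evalCurve u v dlogPsiSqDiv t * (1 - psi7 (u t) (v t)) = evalCurve u v dlogPsi t ^ 2 :=
  fun t ht => by
  have hP := h.evalCurve_star_twoP7_ne_zero t ht
  have hG := h.evalCurve_star_gPlus_ne_zero t ht
  obtain ⟨ψ, hψ⟩ := h.isDiffEval_evalCurve.exists_ringHom t ht
  have hadd := congrArg ψ dlogPsiSqDiv_mul_add
  simp only [psiNum, star_mul', star_pow, map_add, map_mul, map_pow] at hadd
  rw [h.psi7_eq t ht]
  field_simp
  simp only [hψ]
  linear_combination hadd

theorem hasLogDerivAlong_prefactor (h : IsGenericOn V u v) {s p r : ℂ → ℂ}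
    (hs : IsRootBranch 2 V (fun t => 2 * v t + 3 * u t - 14 * u t ^ 2) s)
    (hp : IsRootBranch 14 V (fun t => polyP7 (u t) (v t)) p) (hr : IsRootBranch 7 V u r) :
    HasLogDerivAlong (baseForm u) V (fun t => s t * p t * r t ^ (-2 : ℤ))
      (evalCurve u v dlogFactor) := by
  have hφ := h.isDiffEval_evalCurve
  have hu0 : ∀ t ∈ V, u t ≠ 0 := fun t ht => (h.factors_ne_zero ht).1
  have hr0 : ∀ t ∈ V, r t ≠ 0 := fun t ht hrt => hu0 t ht (by rw [← hr.2 t ht, hrt]; simp)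
  have hsfun : ∀ t ∈ V, 2 * v t + 3 * u t - 14 * u t ^ 2 =
      -1 * evalCurve u v (star gPlus) t := fun t _ => by
    rw [evalCurve_star_gPlus]
    ring
  have hpfun : ∀ t ∈ V, polyP7 (u t) (v t) = 2⁻¹ * evalCurve u v twoP7 t := fun t _ => by
    rw [evalCurve_twoP7, inv_mul_cancel_left₀ two_ne_zero]
  have hslog := HasLogDerivAlong.of_isRootBranch two_ne_zero h.isOpen h.baseForm_ne_zero hs
    (((HasLogDerivAlong.const (-1)).mul (h.hasLogDerivAlong_star der_gPlus)).congr_fun h.isOpen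
      hsfun) fun t ht => hsfun t ht ▸
        mul_ne_zero (by norm_num) (h.evalCurve_star_gPlus_ne_zero t ht)
  have hplog := HasLogDerivAlong.of_isRootBranch (by norm_num) h.isOpen h.baseForm_ne_zero hp
    (((HasLogDerivAlong.const 2⁻¹).mul (hφ.hasLogDerivAlong der_twoP7)).congr_fun h.isOpen
      hpfun) fun t ht => hpfun t ht ▸ mul_ne_zero (by norm_num) (h.evalCurve_twoP7_ne_zero t ht)
  have hrlog := (HasLogDerivAlong.of_isRootBranch (by norm_num) h.isOpen h.baseForm_ne_zero hr
    h.hasLogDerivAlong_u hu0).pow 2 |>.inv fun t ht => pow_ne_zero 2 (hr0 t ht)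
  refine (((hslog.mul hplog).mul hrlog).congr_fun h.isOpen fun t _ => ?_).congr_log fun t ht => ?_
  · rw [zpow_neg, zpow_ofNat]
  · obtain ⟨ψ, hψ⟩ := hφ.exists_ringHom t ht
    have h14 := congrArg ψ fourteen_mul_dlogFactor
    simp only [map_sub, map_add, map_mul, map_ofNat] at h14
    simp only [hψ]
    push_cast
    linear_combination -h14 / 14

theorem isSolutionAlong_W₇ (h : IsGenericOn V u v) {s p r : ℂ → ℂ}
    (hs : IsRootBranch 2 V (fun t => 2 * v t + 3 * u t - 14 * u t ^ 2) s)
    (hp : IsRootBranch 14 V (fun t => polyP7 (u t) (v t)) p) (hr : IsRootBranch 7 V u r)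
    (hΨ : ∀ t ∈ V, ‖psi7 (u t) (v t)‖ < 1) :
    IsSolutionAlong (baseForm u) V (odeOpAt u v) fun t => s t * p t * r t ^ (-2 : ℤ) *
      hyp3F2 (-1 / 14) (1 / 14) (5 / 14) (1 / 7) (5 / 7) (psi7 (u t) (v t)) := by
  have hφ := h.isDiffEval_evalCurve
  have hG (k : Fin 3) : HasDerivAlong (baseForm u) V
      (fun t => eulerW₇ (psi7 (u t) (v t)) k.castSucc)
      fun t => (odeOpAt u v t).ℓ 0 * eulerW₇ (psi7 (u t) (v t)) k.succ := by
    refine ((HasDerivAlong.const (14 ^ (k : ℕ))).mul (HasDerivAlong.comp (fun t ht =>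
      hasDerivAt_eulerSeries_hypCoeff (hΨ t ht) (h.psi7_ne_zero t ht) k)
      h.hasLogDerivAlong_psi7)).congr_deriv fun t ht => ?_
    have hψ0 := h.psi7_ne_zero t ht
    simp only [eulerW₇, odeOpAt, PulledBackOp.map, odeOp_ℓ, Function.comp_apply, jet,
      Fin.val_zero, Function.iterate_zero_apply, Fin.val_succ]
    field_simp
    ring
  have hsol := IsSolutionAlong.of_chainJet (L := odeOpAt u v) (hφ.isJet dlogPsi)
    (hφ.isJet dlogFactor) (h.hasLogDerivAlong_prefactor hs hp hr) hG fun t ht => ?_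
  · simpa only [eulerW₇, Fin.val_zero, pow_zero, one_mul, ← hyp3F2_eq_eulerSeries] using hsol
  · obtain ⟨ψ, hψ⟩ := hφ.exists_ringHom t ht
    have hT := h.dlogPsiSqDiv_mul_one_sub_psi7 t ht
    simp only [hψ] at hT
    simp only [odeOpAt, PulledBackOp.map, odeOp_ℓ, odeOp_r, Function.comp_apply, jet,
      Fin.val_zero, Function.iterate_zero_apply, Matrix.cons_val, hψ, map_sub, map_mul, map_pow,
      map_ofNat, ← hT]
    linear_combination ψ dlogPsiSqDiv * eulerW₇_ode (hΨ t ht)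

end IsGenericOn

/-- The coefficients of the equation of `W₇` with respect to `d/du`, as polynomials in `v` over
`ℂ[u]`. -/
noncomputable def odeCoeff (k : Fin 4) : ℂ[X][X] :=
  toBivariate (odeOp.apply
    (chainJet (jet der (algebraMap ℂ[X] CoordRing polyE)) (Pi.single k 1)))

theorem evalEval_toBivariate (x : CoordRing) (t : ℂ) :
    (toBivariate x).evalEval (u t) (v t) = evalCurve u v x t := by
  simp [toBivariate, evalEval, evalCurve, quadEval]
  ring

theorem odeCoeff_three :
    odeCoeff 3 = C (polyF * (2 * polyQ * polyW * polyH * polyL) ^ 2 * polyE ^ 3) := by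
  have hsq : dlogPsi ^ 2 =
      algebraMap ℂ[X] CoordRing (polyF * (2 * polyQ * polyW * polyH * polyL) ^ 2) := by
    rw [pow_two dlogPsi]
    apply QuadraticAlgebra.ext
    · simp only [QuadraticAlgebra.re_mul, re_dlogPsi, im_dlogPsi, QuadraticAlgebra.algebraMap_re]
      ring
    · simp only [QuadraticAlgebra.im_mul, re_dlogPsi, im_dlogPsi, QuadraticAlgebra.algebraMap_im]
      ring
  have hlead : odeOp.apply
      (chainJet (jet der (algebraMap ℂ[X] CoordRing polyE)) (Pi.single 3 1)) =
        dlogPsi ^ 2 * algebraMap ℂ[X] CoordRing polyE ^ 3 := by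
    simp [PulledBackOp.apply, twist, chainJet, jet]
  rw [odeCoeff, hlead, hsq, ← map_pow, ← map_mul, toBivariate,
    QuadraticAlgebra.algebraMap_re, QuadraticAlgebra.algebraMap_im, mul_zero, map_zero, mul_zero,
    add_zero]

theorem exists_odeCoeff_three_ne_zero : ∃ p ∈ curveH7, (odeCoeff 3).evalEval p.1 p.2 ≠ 0 := by
  obtain ⟨y, hy⟩ := IsAlgClosed.exists_pow_nat_eq
    ((1 : ℂ) * (1 - 63 / 4 * 1 + 91 * 1 ^ 2 - 231 * 1 ^ 3 + 224 * 1 ^ 4)) two_pos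
  refine ⟨(1, y), hy, ?_⟩
  simp [odeCoeff_three, evalEval, polyE, polyK, polyF, polyF₀, polyQ, polyW, polyH, polyC, polyL]
  norm_num

theorem odeOpAt_apply_chainJet {t : ℂ} (ψ : CoordRing →+* ℂ) (hψ : ∀ x, evalCurve u v x t = ψ x)
    (k : Fin 4) :
    (odeOpAt u v t).apply
        (chainJet ((evalCurve u v · t) ∘ jet der (algebraMap ℂ[X] CoordRing polyE))
          (Pi.single k 1)) =
      (odeCoeff k).evalEval (u t) (v t) := by
  have hjet : chainJet (ψ ∘ jet der (algebraMap ℂ[X] CoordRing polyE)) (Pi.single k 1) =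
      ψ ∘ chainJet (jet der (algebraMap ℂ[X] CoordRing polyE)) (Pi.single k 1) := by
    funext i
    fin_cases i <;> fin_cases k <;> simp [chainJet, map_ofNat ψ]
  simp only [odeOpAt, odeCoeff, evalEval_toBivariate, hψ]
  rw [hjet, PulledBackOp.apply_map]

theorem IsGenericOn.satisfiesODE (h : IsGenericOn V u v) {W : ℂ → ℂ}
    (hW : DifferentiableOn ℂ W V) (hsol : IsSolutionAlong (baseForm u) V (odeOpAt u v) W) :
    SatisfiesODE odeCoeff V u v W := fun t ht => by
  obtain ⟨ψ, hψ⟩ := h.isDiffEval_evalCurve.exists_ringHom t ht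
  have hsum := hsol.sum_iterate_derivU_eq_zero h.isOpen h.differentiableOn_u h.deriv_ne_zero
    (h.isDiffEval_evalCurve.isJet (algebraMap ℂ[X] CoordRing polyE)) (fun t ht => by
      simp [jet, evalCurve_algebraMap, baseForm, mul_div_cancel₀ _ (h.ne_zero t ht)]) hW t ht
  simpa only [odeOpAt_apply_chainJet ψ hψ] using hsum

end curveH7

open curveH7

variable {Ω V : Set ℂ} {u v W : ℂ → ℂ}

theorem IsRootBranch.mono {n : ℕ} {f s : ℂ → ℂ} {V' : Set ℂ} (h : IsRootBranch n V f s)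
    (hV' : V' ⊆ V) : IsRootBranch n V' f s :=
  ⟨h.1.mono hV', fun t ht => h.2 t (hV' ht)⟩

theorem exists_eval_ne_zero (hV : IsOpen V) (hne : V.Nonempty) (hu : ∀ t ∈ V, deriv u t ≠ 0)
    {p : ℂ[X]} (hp : p ≠ 0) : ∃ t ∈ V, p.eval (u t) ≠ 0 := by
  obtain ⟨t₀, ht₀⟩ := hne
  have havoid : ∀ᶠ t in nhdsWithin t₀ {t₀}ᶜ, ∀ x ∈ p.roots.toFinset, u t ≠ x :=
    (Filter.eventually_all_finset _).2 fun x _ =>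
      (differentiableAt_of_deriv_ne_zero (hu t₀ ht₀)).hasDerivAt.eventually_ne (hu t₀ ht₀)
  obtain ⟨t, ht, htV⟩ := (havoid.and (nhdsWithin_le_nhds (hV.mem_nhds ht₀))).exists
  exact ⟨t, htV, fun h0 => ht (u t) (Multiset.mem_toFinset.2 ((mem_roots hp).2 h0)) rfl⟩

namespace IsParamH7

theorem isGenericOn (hΩ : IsParamH7 Ω u v) (hV : IsOpen V) (hVΩ : V ⊆ Ω) :
    IsGenericOn {t ∈ V | polyE.eval (u t) ≠ 0} u v where
  isOpen := (polyE.continuous.comp_continuousOn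
    (hΩ.differentiableOn_u.mono hVΩ).continuousOn).isOpen_inter_preimage hV isOpen_compl_singleton
  differentiableOn_u := hΩ.differentiableOn_u.mono fun _ ht => hVΩ ht.1
  differentiableOn_v := hΩ.differentiableOn_v.mono fun _ ht => hVΩ ht.1
  mem_curve t ht := hΩ.mem_curve t (hVΩ ht.1)
  deriv_ne_zero t ht := hΩ.deriv_ne_zero t (hVΩ ht.1)
  ne_zero _ ht := ht.2

theorem satisfiesODE_of_subset (hΩ : IsParamH7 Ω u v) {c : Fin 4 → ℂ[X][X]}
    (hW : DifferentiableOn ℂ W Ω) (hV : IsOpen V) (hne : V.Nonempty) (hVΩ : V ⊆ Ω)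
    (h : SatisfiesODE c V u v W) : SatisfiesODE c Ω u v W := by
  have heval (q : ℂ[X][X]) : DifferentiableOn ℂ (fun t => q.evalEval (u t) (v t)) Ω := by
    induction q using Polynomial.induction_on' with
    | add q₁ q₂ h₁ h₂ => simpa only [evalEval_add] using h₁.fun_add h₂
    | monomial n g =>
      simp only [evalEval, eval_monomial, eval_mul, eval_pow, eval_C]
      exact (g.differentiable.comp_differentiableOn hΩ.differentiableOn_u).mul
        (hΩ.differentiableOn_v.pow n)
  have hsum : DifferentiableOn ℂ (fun t => ∑ k : Fin 4, (c k).evalEval (u t) (v t) *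
      ((derivU u)^[(k : ℕ)] W) t) Ω :=
    DifferentiableOn.fun_sum fun k _ => (heval (c k)).mul
      (differentiableOn_iterate_derivU hΩ.isOpen hΩ.differentiableOn_u hΩ.deriv_ne_zero hW k)
  obtain ⟨t₀, ht₀⟩ := hne
  exact (hsum.analyticOnNhd hΩ.isOpen).eqOn_zero_of_preconnected_of_eventuallyEq_zero
    hΩ.isPreconnected (hVΩ ht₀) (Filter.eventuallyEq_of_mem (hV.mem_nhds ht₀) h)

theorem satisfiesODE_of_isSolutionAlong (hΩ : IsParamH7 Ω u v) (hW : DifferentiableOn ℂ W Ω)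
    (hV : IsOpen V) (hne : V.Nonempty) (hVΩ : V ⊆ Ω)
    (h : ∀ V' ⊆ V, IsGenericOn V' u v → IsSolutionAlong (baseForm u) V' (odeOpAt u v) W) :
    SatisfiesODE odeCoeff Ω u v W := by
  have hE : polyE ≠ 0 := fun h0 => by
    have heval := congrArg (Polynomial.eval 1) h0
    simp [polyE, polyK, polyF, polyF₀, polyQ, polyW, polyH, polyC] at heval
    norm_num at heval
  have hgen := hΩ.isGenericOn hV hVΩ
  exact hΩ.satisfiesODE_of_subset hW hgen.isOpen
    (exists_eval_ne_zero hV hne (fun t ht => hΩ.deriv_ne_zero t (hVΩ ht)) hE)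
    (fun _ ht => hVΩ ht.1)
    (hgen.satisfiesODE (hW.mono fun _ ht => hVΩ ht.1) (h _ (Set.sep_subset _ _) hgen))

theorem satisfiesODE_W₀ (hΩ : IsParamH7 Ω u v) :
    SatisfiesODE odeCoeff Ω u v fun t => 4 * u t - 1 := fun t ht =>
  hΩ.satisfiesODE_of_isSolutionAlong ((hΩ.differentiableOn_u.const_mul 4).sub_const 1)
    hΩ.isOpen ⟨t, ht⟩ subset_rfl (fun _ _ hgen => hgen.isSolutionAlong_W₀) t ht

theorem satisfiesODE_W₇ (hΩ : IsParamH7 Ω u v) (hW : IsBranchW7 Ω u v W) :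
    SatisfiesODE odeCoeff Ω u v W := by
  obtain ⟨hd, V, s, p, r, hVΩ, hV, hne, hs, hp, hr, h⟩ := hW
  exact hΩ.satisfiesODE_of_isSolutionAlong hd hV hne hVΩ fun V' hV' hgen =>
    (hgen.isSolutionAlong_W₇ (hs.mono hV') (hp.mono hV') (hr.mono hV')
      fun t ht => (h t (hV' ht)).2.1).congr_fun fun t ht => (h t (hV' ht)).2.2

theorem satisfiesODE_Wpm (hΩ : IsParamH7 Ω u v) {ε : ℂ} (hε : ε ^ 2 = 1)
    (hW : IsBranchWpm ε Ω u v W) : SatisfiesODE odeCoeff Ω u v W := by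
  obtain ⟨hd, V, g, hVΩ, hV, hne, hg, h⟩ := hW
  refine hΩ.satisfiesODE_of_isSolutionAlong hd hV hne hVΩ fun V' hV' hgen =>
    hgen.isSolutionAlong_Wpm (g := fun t => ε * g t)
      ⟨(hg.1.mono hV').const_mul ε, fun t ht => ?_⟩ ⟨h.1.mono hV', fun t ht => ?_⟩
  · rw [mul_pow, hε, one_mul, hg.2 t (hV' ht)]
  · rw [h.2 t (hV' ht)]
    ring

end IsParamH7

theorem mainTheorem3 :
    ∃ c : Fin 4 → Polynomial (Polynomial ℂ),
      (∃ p ∈ curveH7, (c 3).evalEval p.1 p.2 ≠ 0) ∧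
      ∀ (Ω : Set ℂ) (u v : ℂ → ℂ), IsParamH7 Ω u v →
        (∀ W : ℂ → ℂ, IsBranchW7 Ω u v W → SatisfiesODE c Ω u v W) ∧
        SatisfiesODE c Ω u v (fun t => 4 * u t - 1) ∧
        (∀ W : ℂ → ℂ, IsBranchWpm 1 Ω u v W → SatisfiesODE c Ω u v W) ∧
        (∀ W : ℂ → ℂ, IsBranchWpm (-1) Ω u v W → SatisfiesODE c Ω u v W) :=
  ⟨odeCoeff, exists_odeCoeff_three_ne_zero, fun _ _ _ hΩ => ⟨fun _ => hΩ.satisfiesODE_W₇,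
    hΩ.satisfiesODE_W₀, fun _ => hΩ.satisfiesODE_Wpm (one_pow 2),
    fun _ => hΩ.satisfiesODE_Wpm (by norm_num)⟩⟩
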